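/- Let $n \ge 0$ be an integer, let $\mathrm{Sym}(n,\mathbb{C})$ be the complex vector space of symmetric complex $n\times n$ matrices, and let $$\mathfrak{D}_n = \{W \in \mathrm{Sym}(n,\mathbb{C}) : I - W^*W \text{ is positive definite}\}$$ be the bounded realization of the Siegel space, with closure $\overline{\mathfrak{D}_n}$ in $\mathrm{Sym}(n,\mathbb{C})$. The Shilov boundary of $\mathfrak{D}_n$ is the smallest closed subset $S \subseteq \overline{\mathfrak{D}_n}$ such that for every function $f$ that is holomorphic on $\mathfrak{D}_n$ and continuous on $\overline{\mathfrak{D}_n}$, the maximum of $|f|$ over $\overline{\mathfrak{D}_n}$ is attained at a point of $S$. Theorem. The Shilov boundary of $\mathfrak{D}_n$ exists and is equal to $\mathrm{Sym}(n,\mathbb{C}) \cap \mathrm{U}(n)$, the set of symmetric unitary matrices. That is, this set is closed and contained in $\overline{\mathfrak{D}_n}$, has the above maximum property, and is contained in every closed subset of $\overline{\mathfrak{D}_n}$ with that property. -/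

import Mathlib

open scoped ComplexOrder Matrix Matrix.Norms.L2Operator

/-- `Sym(n,ℂ)`: the complex vector space of symmetric complex `n × n` matrices. It is a normed
space for the operator norm; since it is finite dimensional, the choice of norm affects neither
its topology nor the notion of a holomorphic function on it. -/
def SymMat (n : ℕ) : Submodule ℂ (Matrix (Fin n) (Fin n) ℂ) where
  carrier := {W | W.IsSymm}
  add_mem' hA hB := Matrix.IsSymm.add hA hB
  zero_mem' := Matrix.isSymm_zero
  smul_mem' c _ hA := Matrix.IsSymm.smul hA c

/-- The bounded realization of the Siegel space, an open subset of `Sym(n,ℂ)`: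
the symmetric matrices `W` such that `I - W*W` is positive definite. -/
def SiegelDisk (n : ℕ) : Set (SymMat n) :=
  {W | (1 - (W : Matrix (Fin n) (Fin n) ℂ)ᴴ * (W : Matrix (Fin n) (Fin n) ℂ)).PosDef}

section Shilov

variable {E : Type*} [NormedAddCommGroup E] [NormedSpace ℂ E]

/-- `S` is a closed subset of the closure of `D` such that, for every function `f` that is
holomorphic on `D` and continuous on the closure of `D`, the maximum of `|f|` over the closure
of `D` is attained at a point of `S`. -/
structure IsMaximizingSet (D S : Set E) : Prop where
  isClosed : IsClosed S
  subset_closure : S ⊆ closure D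
  exists_isMaxOn : ∀ f : E → ℂ, DiffContOnCl ℂ f D →
    ∃ z ∈ S, IsMaxOn (fun w => ‖f w‖) (closure D) z

/-- `S` is the Shilov boundary of `D`: the smallest (for inclusion) closed subset of the closure
of `D` on which all functions holomorphic on `D` and continuous on its closure attain their
maximum modulus. -/
def IsShilovBoundary (D S : Set E) : Prop :=
  IsLeast {T : Set E | IsMaximizingSet D T} S

end Shilov

/-! The closure of the domain is the closed unit ball of `SymMat n` for the operator norm. A
symmetric contraction that is not unitary is the centre of a nontrivial affine disc in this ball
(`exists_isSymm_disc`), so the maximum principle spreads a maximum of |f| over the disc. Among the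
maximum points, one of largest Frobenius norm must then be unitary. Conversely each symmetric
unitary U is the only peak of exp(tr(UᴴW)), so every maximizing set contains it. -/

open Metric Set Filter Topology

/-! ### Contractions and their defects -/

namespace Matrix

variable {m : Type*} [Fintype m] [DecidableEq m]

open scoped MatrixOrder in
theorem posSemidef_one_sub_of_norm_le_one {Q : Matrix m m ℂ} (hQ : Q.IsHermitian)
    (h : ‖Q‖ ≤ 1) : (1 - Q).PosSemidef := by
  have h1 : Q ≤ algebraMap ℝ (Matrix m m ℂ) ‖Q‖ :=
    IsSelfAdjoint.le_algebraMap_norm_self hQ.isSelfAdjoint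
  have h2 : algebraMap ℝ (Matrix m m ℂ) ‖Q‖ ≤ algebraMap ℝ (Matrix m m ℂ) 1 :=
    algebraMap_mono _ h
  rw [map_one] at h2
  exact Matrix.le_iff.mp (h1.trans h2)

theorem norm_conjTranspose_mul_self_le_one_iff (W : Matrix m m ℂ) :
    ‖Wᴴ * W‖ ≤ 1 ↔ ‖W‖ ≤ 1 := by
  rw [Matrix.l2_opNorm_conjTranspose_mul_self, ← abs_le_one_iff_mul_self_le_one,
    abs_of_nonneg (norm_nonneg W)]

open scoped MatrixOrder in
theorem posSemidef_one_sub_conjTranspose_mul_self_iff (W : Matrix m m ℂ) :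
    (1 - Wᴴ * W).PosSemidef ↔ ‖W‖ ≤ 1 := by
  rw [← norm_conjTranspose_mul_self_le_one_iff]
  refine ⟨fun h => ?_, posSemidef_one_sub_of_norm_le_one (isHermitian_conjTranspose_mul_self W)⟩
  have h0 : 0 ≤ Wᴴ * W := (posSemidef_conjTranspose_mul_self W).nonneg
  exact (CStarAlgebra.norm_le_one_iff_of_nonneg _ h0).mpr (Matrix.le_iff.mpr h)

theorem posDef_one_sub_conjTranspose_mul_self {W : Matrix m m ℂ} (h : ‖W‖ < 1) :
    (1 - Wᴴ * W).PosDef := by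
  obtain ⟨r, hWr, hr1⟩ := exists_between h
  have hr0 : 0 < r := (norm_nonneg W).trans_lt hWr
  have hs : ‖((r⁻¹ : ℝ) : ℂ) • W‖ ≤ 1 := by
    rw [norm_smul, Complex.norm_real, Real.norm_of_nonneg (by positivity), inv_mul_le_iff₀ hr0,
      mul_one]
    exact hWr.le
  have h1 := (posSemidef_one_sub_conjTranspose_mul_self_iff _).mpr hs
  -- 1 - WᴴW = (1 - r²) + r²(1 - (W/r)ᴴ(W/r)), where W/r is still a contraction.
  have h2 : (((r ^ 2 : ℝ) : ℂ) • (1 - (((r⁻¹ : ℝ) : ℂ) • W)ᴴ * (((r⁻¹ : ℝ) : ℂ) • W))).PosSemidef :=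
    h1.smul (by exact_mod_cast sq_nonneg r)
  have h3 : (((1 - r ^ 2 : ℝ) : ℂ) • (1 : Matrix m m ℂ)).PosDef :=
    PosDef.one.smul (by
      have : (0 : ℝ) < 1 - r ^ 2 := by nlinarith
      exact_mod_cast this)
  have h4 := h3.add_posSemidef h2
  convert h4 using 1
  have hc : (r : ℂ) ≠ 0 := by exact_mod_cast hr0.ne'
  ext i j
  simp only [conjTranspose_smul, Complex.star_def, Complex.conj_ofReal, Matrix.smul_mul, Matrix.mul_smul,
    add_apply, sub_apply, smul_apply, smul_eq_mul]
  push_cast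
  field_simp
  ring

theorem norm_one_sub_mul_conjTranspose_le_one {W : Matrix m m ℂ} (h : ‖W‖ ≤ 1) :
    ‖1 - W * Wᴴ‖ ≤ 1 := by
  open scoped MatrixOrder in
  have h1 : (1 - Wᴴᴴ * Wᴴ).PosSemidef :=
    (posSemidef_one_sub_conjTranspose_mul_self_iff _).mpr (by rwa [l2_opNorm_conjTranspose])
  rw [conjTranspose_conjTranspose] at h1
  refine (CStarAlgebra.norm_le_one_iff_of_nonneg _ h1.nonneg).mpr (Matrix.le_iff.mpr ?_)
  simpa using posSemidef_self_mul_conjTranspose W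

/-- A contraction stays a contraction when `(1 - W Wᴴ) A (1 - Wᴴ W)` with `A` small is added. -/
theorem norm_add_defect_mul_mul_defect_le_one {W A : Matrix m m ℂ} (h : ‖W‖ ≤ 1)
    (hA : ‖A‖ ≤ 1 / 3) : ‖W + (1 - W * Wᴴ) * A * (1 - Wᴴ * W)‖ ≤ 1 := by
  have hE1 := norm_one_sub_mul_conjTranspose_le_one h
  have hEpos : (1 - Wᴴᴴ * Wᴴ).PosSemidef :=
    (posSemidef_one_sub_conjTranspose_mul_self_iff _).mpr (by rwa [l2_opNorm_conjTranspose])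
  have hDpos := (posSemidef_one_sub_conjTranspose_mul_self_iff _).mpr h
  rw [conjTranspose_conjTranspose] at hEpos
  have hWE : Wᴴ * (1 - W * Wᴴ) = (1 - Wᴴ * W) * Wᴴ := by noncomm_ring
  have hEW : (1 - W * Wᴴ) * W = W * (1 - Wᴴ * W) := by noncomm_ring
  have hD : 1 - Wᴴ * W - (1 - Wᴴ * W) * (1 - Wᴴ * W) = Wᴴ * (1 - W * Wᴴ) * W := by
    noncomm_ring
  have hWW : Wᴴ * W = 1 - (1 - Wᴴ * W) := by abel
  generalize 1 - W * Wᴴ = E at *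
  generalize 1 - Wᴴ * W = D at *
  -- Calling this matrix Q, 1 - (W + EAD)ᴴ(W + EAD) = WᴴEW + D(1 - Q)D, and ‖Q‖ ≤ 1/3 + 1/3 + 1/9.
  have hQ : ‖Wᴴ * A + Aᴴ * W + Aᴴ * (E * E) * A‖ ≤ 1 := by
    have h1 : ‖Wᴴ * A‖ ≤ 1 * (1 / 3) := (norm_mul_le _ _).trans (by
      rw [l2_opNorm_conjTranspose]; gcongr)
    have h2 : ‖Aᴴ * W‖ ≤ (1 / 3) * 1 := (norm_mul_le _ _).trans (by
      rw [l2_opNorm_conjTranspose]; gcongr)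
    have h3 : ‖E * E‖ ≤ 1 * 1 := (norm_mul_le _ _).trans (by gcongr)
    have h4 : ‖Aᴴ * (E * E) * A‖ ≤ (1 / 3) * (1 * 1) * (1 / 3) :=
      (norm_mul_le _ _).trans (mul_le_mul ((norm_mul_le _ _).trans (by
        rw [l2_opNorm_conjTranspose]; gcongr)) hA (norm_nonneg _) (by norm_num))
    have h5 := norm_add₃_le (a := Wᴴ * A) (b := Aᴴ * W) (c := Aᴴ * (E * E) * A)
    linarith
  have hQh : (Wᴴ * A + Aᴴ * W + Aᴴ * (E * E) * A).IsHermitian := by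
    simp only [IsHermitian, conjTranspose_add, conjTranspose_mul, conjTranspose_conjTranspose,
      hEpos.1.eq, Matrix.mul_assoc]
    abel
  have h6 := (hEpos.conjTranspose_mul_mul_same W).add
    ((posSemidef_one_sub_of_norm_le_one hQh hQ).conjTranspose_mul_mul_same D)
  rw [← posSemidef_one_sub_conjTranspose_mul_self_iff]
  convert h6 using 1
  rw [← hD, conjTranspose_add, conjTranspose_mul, conjTranspose_mul, hEpos.1.eq, hDpos.1.eq]
  have e1 : (Wᴴ + D * (Aᴴ * E)) * (W + E * A * D)
      = Wᴴ * W + (Wᴴ * E) * A * D + D * Aᴴ * (E * W) + D * (Aᴴ * (E * E) * A) * D := by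
    noncomm_ring
  rw [e1, hWW, hWE, hEW]
  noncomm_ring

theorem re_trace_conjTranspose_mul_self_pos {k : Type*} [Fintype k] {V : Matrix k k ℂ} (hV : V ≠ 0) :
    0 < (Vᴴ * V).trace.re := by
  have h0 := (posSemidef_conjTranspose_mul_self V).trace_nonneg
  rw [Complex.nonneg_iff] at h0
  refine lt_of_le_of_ne h0.1 fun h => hV ?_
  rw [← trace_conjTranspose_mul_self_eq_zero_iff]
  exact Complex.ext h.symm h0.2.symm

theorem re_trace_conjTranspose_mul_self_add_sub {k : Type*} [Fintype k] (W V : Matrix k k ℂ) :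
    ((W + V)ᴴ * (W + V)).trace.re + ((W - V)ᴴ * (W - V)).trace.re
      = 2 * (Wᴴ * W).trace.re + 2 * (Vᴴ * V).trace.re := by
  simp only [conjTranspose_add, conjTranspose_sub, Matrix.add_mul, Matrix.sub_mul, Matrix.mul_add,
    Matrix.mul_sub, trace_add, trace_sub, Complex.add_re, Complex.sub_re]
  ring

theorem re_trace_conjTranspose_mul_self_le_card {W : Matrix m m ℂ} (h : ‖W‖ ≤ 1) :
    (Wᴴ * W).trace.re ≤ Fintype.card m := by
  have h0 := ((posSemidef_one_sub_conjTranspose_mul_self_iff W).mpr h).trace_nonneg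
  rw [Complex.nonneg_iff, trace_sub, trace_one] at h0
  simpa using h0.1

/-- The real part of the pairing with a unitary matrix peaks, among contractions, exactly there. -/
theorem eq_of_card_le_re_trace {U W : Matrix m m ℂ} (hU : U ∈ unitaryGroup m ℂ) (h : ‖W‖ ≤ 1)
    (hUW : (Fintype.card m : ℝ) ≤ (Uᴴ * W).trace.re) : W = U := by
  by_contra hne
  -- The squared Frobenius norm of W - U is tr(WᴴW) - 2 Re tr(UᴴW) + card m ≤ 0.
  have h1 := re_trace_conjTranspose_mul_self_pos (sub_ne_zero.mpr hne)
  have h2 := re_trace_conjTranspose_mul_self_le_card h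
  have hUU : Uᴴ * U = 1 := mem_unitaryGroup_iff'.mp hU
  have h3 : (Wᴴ * U).trace.re = (Uᴴ * W).trace.re := by
    rw [← Complex.conj_re, ← Complex.star_def, ← trace_conjTranspose, conjTranspose_mul,
      conjTranspose_conjTranspose]
  rw [conjTranspose_sub, Matrix.sub_mul, Matrix.mul_sub, Matrix.mul_sub, hUU] at h1
  simp only [trace_sub, Complex.sub_re, h3, trace_one, Complex.natCast_re] at h1
  linarith

theorem norm_le_one_of_mem_unitaryGroup {U : Matrix m m ℂ} (hU : U ∈ unitaryGroup m ℂ) :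
    ‖U‖ ≤ 1 := by
  rw [← posSemidef_one_sub_conjTranspose_mul_self_iff, show Uᴴ * U = 1 from
    mem_unitaryGroup_iff'.mp hU, sub_self]
  exact PosSemidef.zero

/-- A symmetric contraction that is not unitary is the centre of a nontrivial disc of symmetric
contractions. -/
theorem exists_isSymm_disc {W : Matrix m m ℂ} (hs : W.IsSymm) (h : ‖W‖ ≤ 1)
    (hU : W ∉ unitaryGroup m ℂ) :
    ∃ V : Matrix m m ℂ, V.IsSymm ∧ V ≠ 0 ∧ ∀ c : ℂ, ‖c‖ ≤ 1 → ‖W + c • V‖ ≤ 1 := by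
  have hD : 1 - Wᴴ * W ≠ 0 := fun h0 =>
    hU (mem_unitaryGroup_iff'.mpr (sub_eq_zero.mp h0).symm)
  have hDt : (1 - Wᴴ * W)ᵀ = 1 - W * Wᴴ := by
    have hc : Wᴴᵀ = Wᴴ := by
      rw [conjTranspose, hs.eq]
      ext i j
      simp [hs.apply i j]
    rw [transpose_sub, transpose_mul, transpose_one, hs.eq, hc]
  obtain ⟨i, j, hij⟩ : ∃ i j, (1 - Wᴴ * W) i j ≠ 0 := by
    by_contra! h0
    exact hD (Matrix.ext h0)
  -- With D = 1 - WᴴW, symmetry of W gives 1 - WWᴴ = Dᵀ, so V = DᵀAD is symmetric with (j, j) entry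
  -- (D i j)²/3 ≠ 0.
  set A : Matrix m m ℂ := diagonal (Pi.single i (1 / 3))
  have hA : ‖A‖ ≤ 1 / 3 := by
    rw [l2_opNorm_diagonal, pi_norm_le_iff_of_nonneg (by norm_num)]
    intro k
    rcases eq_or_ne k i with rfl | hk
    · simp
    · simp [hk]
  refine ⟨(1 - W * Wᴴ) * A * (1 - Wᴴ * W), ?_, ?_, fun c hc => ?_⟩
  · rw [← hDt, IsSymm, transpose_mul, transpose_mul, transpose_transpose, Matrix.mul_assoc,
      diagonal_transpose]
  · intro h0
    have := congrFun (congrFun h0 j) j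
    rw [← hDt, mul_apply] at this
    simp only [A, mul_diagonal, transpose_apply, zero_apply] at this
    rw [Finset.sum_eq_single i (by intro b _ hb; simp [hb]) (by simp)] at this
    simp only [Pi.single_eq_same] at this
    exact mul_ne_zero (mul_ne_zero hij (by norm_num)) hij this
  · have := norm_add_defect_mul_mul_defect_le_one h (A := c • A) (by
      rw [norm_smul]
      nlinarith [norm_nonneg A, norm_nonneg c])
    simpa only [Matrix.mul_smul, Matrix.smul_mul] using this

end Matrix

open Matrix

/-! ### Topology of the domain and of the symmetric unitaries -/

theorem ball_subset_siegelDisk (n : ℕ) : ball (0 : SymMat n) 1 ⊆ SiegelDisk n := fun _ hW =>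
  posDef_one_sub_conjTranspose_mul_self (mem_ball_zero_iff.mp hW)

theorem siegelDisk_subset_closedBall (n : ℕ) : SiegelDisk n ⊆ closedBall (0 : SymMat n) 1 :=
  fun _ hW => mem_closedBall_zero_iff.mpr
    ((posSemidef_one_sub_conjTranspose_mul_self_iff _).mp (PosDef.posSemidef hW))

theorem closure_siegelDisk (n : ℕ) : closure (SiegelDisk n) = closedBall (0 : SymMat n) 1 := by
  refine (closure_minimal (siegelDisk_subset_closedBall n) isClosed_closedBall).antisymm ?_
  rw [← closure_ball (0 : SymMat n) one_ne_zero]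
  exact closure_mono (ball_subset_siegelDisk n)

/-- The set of symmetric unitary matrices. -/
def symUnitary (n : ℕ) : Set (SymMat n) :=
  {W | (W : Matrix (Fin n) (Fin n) ℂ) ∈ Matrix.unitaryGroup (Fin n) ℂ}

theorem symUnitary_subset_closedBall (n : ℕ) : symUnitary n ⊆ closedBall (0 : SymMat n) 1 :=
  fun _ hW => mem_closedBall_zero_iff.mpr (norm_le_one_of_mem_unitaryGroup hW)

theorem isClosed_symUnitary (n : ℕ) : IsClosed (symUnitary n) := by
  have : symUnitary n = {W : SymMat n | (W : Matrix (Fin n) (Fin n) ℂ)ᴴ * W = 1} := by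
    ext W
    exact mem_unitaryGroup_iff'
  rw [this]
  exact isClosed_eq (by fun_prop) continuous_const

theorem isCompact_symUnitary (n : ℕ) : IsCompact (symUnitary n) :=
  (isCompact_closedBall (0 : SymMat n) 1).of_isClosed_subset (isClosed_symUnitary n)
    (symUnitary_subset_closedBall n)

/-! ### Maximum property and minimality -/

/-- The maximum modulus principle on a disc `{w + c • v | ‖c‖ ≤ 1}`. -/
theorem norm_eq_of_isMaxOn_of_disc {E : Type*} [NormedAddCommGroup E] [NormedSpace ℂ E]
    {f : E → ℂ} {K : Set E} {w v : E} (hf : ∀ z ∈ K, DifferentiableAt ℂ f z)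
    (hmax : IsMaxOn (fun z => ‖f z‖) K w) (hdisc : ∀ c : ℂ, ‖c‖ ≤ 1 → w + c • v ∈ K)
    {c : ℂ} (hc : ‖c‖ ≤ 1) : ‖f (w + c • v)‖ = ‖f w‖ := by
  have hd : DiffContOnCl ℂ (fun c : ℂ => f (w + c • v)) (ball 0 1) := by
    refine DifferentiableOn.diffContOnCl fun c hc => ?_
    rw [closure_ball _ one_ne_zero, mem_closedBall_zero_iff] at hc
    have hline : DifferentiableAt ℂ (fun c : ℂ => w + c • v) c :=
      (differentiableAt_id.smul_const v).const_add w
    exact (DifferentiableAt.fun_comp' c (hf _ (hdisc c hc)) hline).differentiableWithinAt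
  have hg0 : f (w + (0 : ℂ) • v) = f w := by rw [zero_smul, add_zero]
  have hgmax : IsMaxOn (norm ∘ fun c : ℂ => f (w + c • v)) (ball 0 1) 0 := fun c hc => by
    change ‖f (w + c • v)‖ ≤ ‖f (w + (0 : ℂ) • v)‖
    rw [hg0]
    exact hmax (hdisc c (mem_ball_zero_iff.mp hc).le)
  rw [← hg0]
  exact Complex.norm_eqOn_closedBall_of_isMaxOn hd hgmax (mem_closedBall_zero_iff.mpr hc)

/-- A function holomorphic at every point of the closed unit ball of `Sym(n,ℂ)` attains its maximum
modulus at a unitary matrix. -/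
theorem exists_symUnitary_isMaxOn_of_differentiableAt {n : ℕ} {f : SymMat n → ℂ}
    (hf : ∀ W ∈ closedBall (0 : SymMat n) 1, DifferentiableAt ℂ f W) :
    ∃ U ∈ symUnitary n, IsMaxOn (fun W => ‖f W‖) (closedBall (0 : SymMat n) 1) U := by
  have hB : IsCompact (closedBall (0 : SymMat n) 1) := isCompact_closedBall _ _
  have hfc : ContinuousOn (fun W => ‖f W‖) (closedBall (0 : SymMat n) 1) :=
    fun W hW => (hf W hW).continuousAt.norm.continuousWithinAt
  obtain ⟨W₀, hW₀, hmax⟩ := hB.exists_isMaxOn ⟨0, by simp⟩ hfc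
  have hKc : IsClosed (closedBall (0 : SymMat n) 1 ∩ (fun W => ‖f W‖) ⁻¹' {‖f W₀‖}) :=
    hfc.preimage_isClosed_of_isClosed isClosed_closedBall isClosed_singleton
  -- W has the largest Frobenius norm among the maximum points of |f|; if V ≠ 0, the parallelogram
  -- law makes W + V or W - V larger.
  obtain ⟨W, ⟨hW, hfW⟩, hWmax⟩ :=
    (hB.of_isClosed_subset hKc inter_subset_left).exists_isMaxOn ⟨W₀, hW₀, rfl⟩
    (f := fun W : SymMat n => ((W : Matrix (Fin n) (Fin n) ℂ)ᴴ * W).trace.re)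
    (Continuous.continuousOn (Complex.continuous_re.comp (Continuous.matrix_trace (by fun_prop))))
  replace hfW : ‖f W‖ = ‖f W₀‖ := hfW
  have hmaxW : IsMaxOn (fun W => ‖f W‖) (closedBall (0 : SymMat n) 1) W := fun Z hZ =>
    (hmax hZ).trans_eq hfW.symm
  refine ⟨W, ?_, hmaxW⟩
  by_contra hU
  obtain ⟨V, hVs, hV0, hV⟩ := exists_isSymm_disc W.2 (mem_closedBall_zero_iff.mp hW) hU
  lift V to SymMat n using hVs
  have hdisc : ∀ c : ℂ, ‖c‖ ≤ 1 → W + c • V ∈ closedBall (0 : SymMat n) 1 := fun c hc => by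
    rw [mem_closedBall_zero_iff, ← Submodule.norm_coe, Submodule.coe_add, Submodule.coe_smul]
    exact hV c hc
  have hconst := fun (c : ℂ) (hc : ‖c‖ ≤ 1) => norm_eq_of_isMaxOn_of_disc hf hmaxW hdisc hc
  have key : ∀ c : ℂ, ‖c‖ ≤ 1 →
      ((W + c • V : Matrix (Fin n) (Fin n) ℂ)ᴴ * (W + c • V)).trace.re
        ≤ ((W : Matrix (Fin n) (Fin n) ℂ)ᴴ * W).trace.re := fun c hc => by
    have h1 := isMaxOn_iff.mp hWmax (W + c • V) ⟨hdisc c hc, (hconst c hc).trans hfW⟩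
    rwa [Submodule.coe_add, Submodule.coe_smul] at h1
  have k1 := key 1 (by simp)
  have k2 := key (-1) (by simp)
  rw [one_smul] at k1
  rw [neg_one_smul, ← sub_eq_add_neg] at k2
  have k3 := re_trace_conjTranspose_mul_self_add_sub (W : Matrix (Fin n) (Fin n) ℂ) V
  have k4 := re_trace_conjTranspose_mul_self_pos hV0
  linarith

/-- The discs may lie in the boundary, where f need not be differentiable. Hence f is replaced by
its dilates f(r W) with r < 1, and r → 1 by compactness of `symUnitary n`. -/
theorem exists_symUnitary_isMaxOn {n : ℕ} {f : SymMat n → ℂ}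
    (hf : DiffContOnCl ℂ f (SiegelDisk n)) :
    ∃ U ∈ symUnitary n, IsMaxOn (fun W => ‖f W‖) (closure (SiegelDisk n)) U := by
  rw [closure_siegelDisk]
  have hfc : ContinuousOn (fun W => ‖f W‖) (closedBall (0 : SymMat n) 1) := by
    rw [← closure_siegelDisk]
    exact hf.continuousOn.norm
  obtain ⟨r, -, hr, hr1⟩ := exists_seq_strictMono_tendsto' (zero_lt_one (α := ℝ))
  have hball : ∀ k, ∀ W ∈ closedBall (0 : SymMat n) 1, ((r k : ℝ) : ℂ) • W ∈ ball (0 : SymMat n) 1 :=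
    fun k W hW => by
    rw [mem_ball_zero_iff, norm_smul, Complex.norm_real, Real.norm_of_nonneg (hr k).1.le]
    rw [mem_closedBall_zero_iff] at hW
    nlinarith [(hr k).1, (hr k).2]
  have hscale : ∀ k, ∃ U ∈ symUnitary n,
      IsMaxOn (fun W => ‖f (((r k : ℝ) : ℂ) • W)‖) (closedBall (0 : SymMat n) 1) U := fun k =>
    exists_symUnitary_isMaxOn_of_differentiableAt
      (f := fun W => f (((r k : ℝ) : ℂ) • W)) fun W hW => by
      have h1 : DifferentiableAt ℂ f (((r k : ℝ) : ℂ) • W) :=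
        hf.differentiableOn.differentiableAt
          (mem_of_superset (isOpen_ball.mem_nhds (hball k W hW)) (ball_subset_siegelDisk n))
      exact DifferentiableAt.comp W h1 (by fun_prop)
  choose u hu hmax using hscale
  obtain ⟨U, hU, φ, hφ, hlim⟩ := (isCompact_symUnitary n).tendsto_subseq hu
  have hrφ : Tendsto (fun k => ((r (φ k) : ℝ) : ℂ)) atTop (𝓝 1) :=
    (Complex.continuous_ofReal.tendsto' 1 1 (by simp)).comp (hr1.comp hφ.tendsto_atTop)
  have hconv : ∀ (w : ℕ → SymMat n) (Z : SymMat n), (∀ k, w k ∈ closedBall (0 : SymMat n) 1) →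
      Z ∈ closedBall (0 : SymMat n) 1 → Tendsto w atTop (𝓝 Z) →
      Tendsto (fun k => ‖f (((r (φ k) : ℝ) : ℂ) • w k)‖) atTop (𝓝 ‖f Z‖) := by
    intro w Z hw hZ hwZ
    refine (hfc Z hZ).tendsto.comp (tendsto_nhdsWithin_iff.mpr ⟨?_, .of_forall fun k =>
      ball_subset_closedBall (hball _ _ (hw k))⟩)
    simpa using hrφ.smul hwZ
  refine ⟨U, hU, fun Z hZ => ?_⟩
  exact le_of_tendsto_of_tendsto' (hconv (fun _ => Z) Z (fun _ => hZ) hZ tendsto_const_nhds)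
    (hconv (u ∘ φ) U (fun k => symUnitary_subset_closedBall n (hu _))
      (symUnitary_subset_closedBall n hU) hlim) fun k => hmax (φ k) hZ

theorem mem_of_isMaximizingSet_siegelDisk {n : ℕ} {T : Set (SymMat n)}
    (hT : IsMaximizingSet (SiegelDisk n) T) {U : SymMat n} (hU : U ∈ symUnitary n) : U ∈ T := by
  let ℓ : SymMat n →ₗ[ℂ] ℂ := Matrix.traceLinearMap (Fin n) ℂ ℂ ∘ₗ
    LinearMap.mulLeft ℂ (U : Matrix (Fin n) (Fin n) ℂ)ᴴ ∘ₗ (SymMat n).subtype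
  -- The modulus of exp(ℓ W) is exp(Re ℓ W), which turns a bound on the real part into one on a
  -- modulus.
  have hd : Differentiable ℂ fun W => Complex.exp (ℓ W) :=
    (LinearMap.toContinuousLinearMap ℓ).differentiable.cexp
  obtain ⟨Z, hZT, hZ⟩ := hT.exists_isMaxOn _ hd.diffContOnCl
  have hUc : U ∈ closure (SiegelDisk n) :=
    (closure_siegelDisk n).symm ▸ symUnitary_subset_closedBall n hU
  have hZc : ‖Z‖ ≤ 1 :=
    mem_closedBall_zero_iff.mp (closure_siegelDisk n ▸ hT.subset_closure hZT)
  have h1 : ‖Complex.exp (ℓ U)‖ ≤ ‖Complex.exp (ℓ Z)‖ := hZ hUc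
  rw [Complex.norm_exp, Complex.norm_exp, Real.exp_le_exp] at h1
  have h2 : ℓ U = n := by
    change ((U : Matrix (Fin n) (Fin n) ℂ)ᴴ * U).trace = n
    rw [show (U : Matrix (Fin n) (Fin n) ℂ)ᴴ * U = 1 from mem_unitaryGroup_iff'.mp hU]
    simp
  rw [h2, Complex.natCast_re] at h1
  have h4 : (Fintype.card (Fin n) : ℝ) ≤ ((U : Matrix (Fin n) (Fin n) ℂ)ᴴ * Z).trace.re := by
    rw [Fintype.card_fin]
    exact h1
  have h3 : Z = U := Subtype.ext (eq_of_card_le_re_trace hU hZc h4)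
  exact h3 ▸ hZT

theorem mainTheorem7 (n : ℕ) :
    IsShilovBoundary (SiegelDisk n)
      {W : SymMat n | (W : Matrix (Fin n) (Fin n) ℂ) ∈ Matrix.unitaryGroup (Fin n) ℂ} :=
  ⟨⟨isClosed_symUnitary n, closure_siegelDisk n ▸ symUnitary_subset_closedBall n,
    fun _ => exists_symUnitary_isMaxOn⟩, fun _ hT _ => mem_of_isMaximizingSet_siegelDisk hT⟩
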